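/- Let $L_2[0,1]$ be the complex Hilbert space of square-integrable functions with respect to Lebesgue measure. Let $u:[0,1]\to[0,\infty)$ be continuous with $u(t)=0$ for at least one $t\in[0,1]$, and let $k\in L_2([0,1]^2)$ satisfy $k(t,s)=\overline{k(s,t)}$ for almost all $(t,s)$. Define on $L_2[0,1]$ the bounded self-adjoint operators $$(Uf)(t)=u(t)f(t),\qquad (Kf)(t)=\int_0^1 k(t,s)f(s)\,ds,\qquad H=U-K;$$ $K$ is compact. For a bounded self-adjoint operator $A$ let $\sigma_e(A)$ be its essential spectrum, i.e. the spectrum of $A$ without those isolated points of the spectrum that are eigenvalues of finite multiplicity, and put $\mathcal E_{\min}(A)=\inf\sigma_e(A)$, $\mathcal E_{\max}(A)=\sup\sigma_e(A)$. The Efimov effect exists for $A$ at a point $\lambda\in\sigma_e(A)$ from the left (right) if there is $\delta>0$ with $(\lambda-\delta,\lambda]\cap\sigma_e(A)=\{\lambda\}$ (respectively $[\lambda,\lambda+\delta)\cap\sigma_e(A)=\{\lambda\}$) and there is a sequence $(\lambda_n)$ of eigenvalues of $A$ with $\lambda_n<\lambda$ (respectively $\lambda_n>\lambda$) for all $n$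 and $\lambda_n\to\lambda$. The Efimov effect exists below (above) the essential spectrum of $A$ if it exists at $\mathcal E_{\min}(A)$ from the left (at $\mathcal E_{\max}(A)$ from the right). Then: (a) if the Efimov effect exists below the essential spectrum of $U-K$, then $K$ has infinitely many positive eigenvalues; (b) if the Efimov effect exists above the essential spectrum of $U-K$, then $K$ has infinitely many negative eigenvalues. -/

import Mathlib

open MeasureTheory Filter Topology
open scoped unitInterval ENNReal ComplexConjugate

namespace Friedrichs

section Spectral

variable {E : Type*} [NormedAddCommGroup E] [InnerProductSpace ℂ E]

/-- The real number `l` is an eigenvalue of the operator `A`. -/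
def IsEigenvalue (A : E →L[ℂ] E) (l : ℝ) : Prop :=
  Module.End.HasEigenvalue (A : E →ₗ[ℂ] E) (l : ℂ)

/-- The (real) spectrum: all real `l` such that `A - l` has no bounded inverse.
For a bounded self-adjoint operator this is the whole spectrum. -/
def realSpectrum (A : E →L[ℂ] E) : Set ℝ :=
  {l : ℝ | (l : ℂ) ∈ spectrum ℂ A}

/-- The discrete spectrum of a bounded self-adjoint operator:
the isolated points of the spectrum which are eigenvalues of finite multiplicity. -/
def discreteSpectrum (A : E →L[ℂ] E) : Set ℝ :=
  {l : ℝ | IsEigenvalue A l ∧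
    FiniteDimensional ℂ (Module.End.eigenspace (A : E →ₗ[ℂ] E) (l : ℂ)) ∧
    ∃ d : ℝ, 0 < d ∧ Set.Ioo (l - d) (l + d) ∩ realSpectrum A = {l}}

/-- The essential spectrum of a bounded self-adjoint operator: the complement of the discrete
spectrum in the spectrum. -/
def essentialSpectrum (A : E →L[ℂ] E) : Set ℝ :=
  realSpectrum A \ discreteSpectrum A

/-- The lower edge of the essential spectrum. -/
noncomputable def lowerEdge (A : E →L[ℂ] E) : ℝ := sInf (essentialSpectrum A)

/-- The upper edge of the essential spectrum. -/
noncomputable def upperEdge (A : E →L[ℂ] E) : ℝ := sSup (essentialSpectrum A)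

/-- The Efimov effect exists at the point `l` from the left: `l` is a point of the essential
spectrum that is isolated from the left in it, and `l` is the limit of a sequence of eigenvalues
that are smaller than `l`. -/
def EfimovLeft (A : E →L[ℂ] E) (l : ℝ) : Prop :=
  l ∈ essentialSpectrum A ∧
  (∃ d : ℝ, 0 < d ∧ Set.Ioc (l - d) l ∩ essentialSpectrum A = {l}) ∧
  ∃ a : ℕ → ℝ, (∀ n, IsEigenvalue A (a n)) ∧ (∀ n, a n < l) ∧ Tendsto a atTop (𝓝 l)

/-- The Efimov effect exists at the point `l` from the right. -/
def EfimovRight (A : E →L[ℂ] E) (l : ℝ) : Prop :=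
  l ∈ essentialSpectrum A ∧
  (∃ d : ℝ, 0 < d ∧ Set.Ico l (l + d) ∩ essentialSpectrum A = {l}) ∧
  ∃ a : ℕ → ℝ, (∀ n, IsEigenvalue A (a n)) ∧ (∀ n, l < a n) ∧ Tendsto a atTop (𝓝 l)

/-- The Efimov effect below the essential spectrum: at its lower edge, from the left. -/
def EfimovBelow (A : E →L[ℂ] E) : Prop := EfimovLeft A (lowerEdge A)

/-- The Efimov effect above the essential spectrum: at its upper edge, from the right. -/
def EfimovAbove (A : E →L[ℂ] E) : Prop := EfimovRight A (upperEdge A)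

end Spectral

/-- The complex Hilbert space `L₂[0,1]` (Lebesgue measure). -/
abbrev L2 : Type := Lp ℂ 2 (volume : Measure I)

/-- The space `L₂([0,1]²)` of kernels (Lebesgue measure). -/
abbrev Kernel2 : Type := Lp ℂ 2 (volume : Measure (I × I))

theorem mul_bound (u : C(I, ℝ)) (f : L2) (t : I) : ‖(u t : ℂ) * f t‖ ≤ ‖u‖ * ‖f t‖ := by
  rw [norm_mul, Complex.norm_real]
  gcongr
  exact u.norm_coe_le_norm t

theorem memLp_mul (u : C(I, ℝ)) (f : L2) :
    MemLp (fun t : I => (u t : ℂ) * f t) 2 volume := by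
  refine MemLp.of_le_mul (Lp.memLp f) ?_ (Eventually.of_forall (mul_bound u f))
  exact (Complex.continuous_ofReal.comp u.continuous).aestronglyMeasurable.mul
    (Lp.aestronglyMeasurable f)

/-- The multiplication operator `(U f)(t) = u(t) f(t)` on `L₂[0,1]`. -/
noncomputable def mulOp (u : C(I, ℝ)) : L2 →L[ℂ] L2 :=
  LinearMap.mkContinuous
    { toFun := fun f => (memLp_mul u f).toLp (fun t : I => (u t : ℂ) * f t)
      map_add' := by
        intro f g
        rw [← MemLp.toLp_add]
        apply MemLp.toLp_congr
        filter_upwards [Lp.coeFn_add f g] with t ht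
        simp only [ht, Pi.add_apply, mul_add]
      map_smul' := by
        intro c f
        rw [RingHom.id_apply, ← MemLp.toLp_const_smul]
        apply MemLp.toLp_congr
        filter_upwards [Lp.coeFn_smul c f] with t ht
        simp only [ht, Pi.smul_apply, smul_eq_mul]
        ring }
    ‖u‖ (by
      intro f
      apply Lp.norm_le_mul_norm_of_ae_le_mul
      filter_upwards [(memLp_mul u f).coeFn_toLp] with t ht
      change ‖(memLp_mul u f).toLp (fun t : I => (u t : ℂ) * f t) t‖ ≤ _
      rw [ht]
      exact mul_bound u f t)

theorem mulOp_apply (u : C(I, ℝ)) (f : L2) :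
    mulOp u f =ᵐ[volume] fun t : I => (u t : ℂ) * f t :=
  (memLp_mul u f).coeFn_toLp

theorem aestronglyMeasurable_kernel (k : Kernel2) (f : L2) :
    AEStronglyMeasurable (fun t : I => ∫ s : I, k (t, s) * f s) volume := by
  have h : StronglyMeasurable (fun p : I × I => k p * f p.2) :=
    (Lp.stronglyMeasurable k).mul ((Lp.stronglyMeasurable f).comp_measurable measurable_snd)
  exact h.integral_prod_right'.aestronglyMeasurable

theorem lintegral_sq (k : Kernel2) :
    ∫⁻ t : I, ∫⁻ s : I, ‖k (t, s)‖ₑ ^ (2 : ℝ) = eLpNorm k 2 volume ^ (2 : ℝ) := by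
  rw [eLpNorm_eq_lintegral_rpow_enorm_toReal two_ne_zero ENNReal.ofNat_ne_top,
    ← ENNReal.rpow_mul]
  simp only [ENNReal.toReal_ofNat]
  norm_num
  exact (lintegral_prod (μ := (volume : Measure I)) (ν := (volume : Measure I)) _
    ((Lp.stronglyMeasurable k).enorm.pow_const 2).aemeasurable).symm

theorem kernel_pointwise (k : Kernel2) (f : L2) (t : I) :
    ∫⁻ s : I, ‖k (t, s) * f s‖ₑ ≤
      (∫⁻ s : I, ‖k (t, s)‖ₑ ^ (2 : ℝ)) ^ (1 / 2 : ℝ) * eLpNorm f 2 volume := by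
  have hk : AEMeasurable (fun s : I => ‖k (t, s)‖ₑ) volume :=
    ((Lp.stronglyMeasurable k).comp_measurable measurable_prodMk_left).enorm.aemeasurable
  have hf : AEMeasurable (fun s : I => ‖f s‖ₑ) volume :=
    (Lp.stronglyMeasurable f).enorm.aemeasurable
  have h := ENNReal.lintegral_mul_le_Lp_mul_Lq (volume : Measure I)
    Real.HolderConjugate.two_two hk hf
  rw [eLpNorm_eq_lintegral_rpow_enorm_toReal two_ne_zero ENNReal.ofNat_ne_top]
  simp only [ENNReal.toReal_ofNat]
  simpa only [Pi.mul_apply, enorm_mul] using h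

theorem integrable_kernel (k : Kernel2) (f : L2) :
    ∀ᵐ t : I, Integrable (fun s : I => k (t, s) * f s) volume := by
  have hm : Measurable (fun t : I => ∫⁻ s : I, ‖k (t, s)‖ₑ ^ (2 : ℝ)) :=
    ((Lp.stronglyMeasurable k).enorm.pow_const (2 : ℝ)).lintegral_prod_right'
  have hfin : ∫⁻ t : I, ∫⁻ s : I, ‖k (t, s)‖ₑ ^ (2 : ℝ) ≠ ⊤ := by
    rw [lintegral_sq]
    exact ENNReal.rpow_ne_top_of_nonneg (by norm_num) (Lp.eLpNorm_ne_top k)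
  filter_upwards [ae_lt_top hm hfin] with t ht
  refine ⟨(((Lp.stronglyMeasurable k).comp_measurable measurable_prodMk_left).mul
    (Lp.stronglyMeasurable f)).aestronglyMeasurable, ?_⟩
  refine lt_of_le_of_lt (kernel_pointwise k f t) ?_
  exact ENNReal.mul_lt_top (ENNReal.rpow_lt_top_of_nonneg (by norm_num) ht.ne)
    (Lp.eLpNorm_lt_top f)

theorem eLpNorm_kernel (k : Kernel2) (f : L2) :
    eLpNorm (fun t : I => ∫ s : I, k (t, s) * f s) 2 volume ≤
      eLpNorm k 2 volume * eLpNorm f 2 volume := by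
  rw [← ENNReal.rpow_le_rpow_iff (z := 2) (by norm_num), ENNReal.mul_rpow_of_nonneg _ _ (by norm_num),
    ← lintegral_sq]
  have hm : Measurable (fun t : I => ∫⁻ s : I, ‖k (t, s)‖ₑ ^ (2 : ℝ)) :=
    ((Lp.stronglyMeasurable k).enorm.pow_const (2 : ℝ)).lintegral_prod_right'
  rw [← lintegral_mul_const _ hm,
    eLpNorm_eq_lintegral_rpow_enorm_toReal two_ne_zero ENNReal.ofNat_ne_top, ← ENNReal.rpow_mul]
  simp only [ENNReal.toReal_ofNat]
  rw [one_div_mul_cancel (by norm_num), ENNReal.rpow_one]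
  apply lintegral_mono
  intro t
  calc ‖∫ s : I, k (t, s) * f s‖ₑ ^ (2 : ℝ)
      ≤ ((∫⁻ s : I, ‖k (t, s)‖ₑ ^ (2 : ℝ)) ^ (1 / 2 : ℝ) * eLpNorm f 2 volume) ^ (2 : ℝ) := by
        gcongr
        exact (enorm_integral_le_lintegral_enorm _).trans (kernel_pointwise k f t)
    _ = (∫⁻ s : I, ‖k (t, s)‖ₑ ^ (2 : ℝ)) * eLpNorm f 2 volume ^ (2 : ℝ) := by
        rw [ENNReal.mul_rpow_of_nonneg _ _ (by norm_num), ← ENNReal.rpow_mul]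
        norm_num

theorem memLp_kernel (k : Kernel2) (f : L2) :
    MemLp (fun t : I => ∫ s : I, k (t, s) * f s) 2 volume :=
  ⟨aestronglyMeasurable_kernel k f, (eLpNorm_kernel k f).trans_lt
    (ENNReal.mul_lt_top (Lp.eLpNorm_lt_top k) (Lp.eLpNorm_lt_top f))⟩

/-- The integral operator `(K f)(t) = ∫₀¹ k(t,s) f(s) ds` on `L₂[0,1]`. -/
noncomputable def integralOp (k : Kernel2) : L2 →L[ℂ] L2 :=
  LinearMap.mkContinuous
    { toFun := fun f => (memLp_kernel k f).toLp (fun t : I => ∫ s : I, k (t, s) * f s)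
      map_add' := by
        intro f g
        rw [← MemLp.toLp_add]
        apply MemLp.toLp_congr
        filter_upwards [integrable_kernel k f, integrable_kernel k g] with t hf hg
        rw [Pi.add_apply, ← integral_add hf hg]
        apply integral_congr_ae
        filter_upwards [Lp.coeFn_add f g] with s hs
        simp only [hs, Pi.add_apply, mul_add]
      map_smul' := by
        intro c f
        rw [RingHom.id_apply, ← MemLp.toLp_const_smul]
        apply MemLp.toLp_congr
        refine Eventually.of_forall fun t => ?_
        rw [Pi.smul_apply, ← integral_smul]
        apply integral_congr_ae
        filter_upwards [Lp.coeFn_smul c f] with s hs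
        simp only [hs, Pi.smul_apply, smul_eq_mul]
        ring }
    ‖k‖ (by
      intro f
      change ‖(memLp_kernel k f).toLp (fun t : I => ∫ s : I, k (t, s) * f s)‖ ≤ _
      rw [Lp.norm_toLp, Lp.norm_def, Lp.norm_def, ← ENNReal.toReal_mul]
      exact ENNReal.toReal_mono
        (ENNReal.mul_ne_top (Lp.eLpNorm_ne_top k) (Lp.eLpNorm_ne_top f)) (eLpNorm_kernel k f))

theorem integralOp_apply (k : Kernel2) (f : L2) :
    integralOp k f =ᵐ[volume] fun t : I => ∫ s : I, k (t, s) * f s :=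
  (memLp_kernel k f).coeFn_toLp

/-- The kernel is Hermitian: `k(t,s)` is the complex conjugate of `k(s,t)`. -/
def IsHermitianKernel (k : Kernel2) : Prop :=
  ∀ᵐ p : I × I, k (p.1, p.2) = conj (k (p.2, p.1))

end Friedrichs

namespace Friedrichs

/-! ### Symmetric operators on an abstract Hilbert space. -/

section Abstract

variable {E : Type*} [NormedAddCommGroup E] [InnerProductSpace ℂ E]

/-! The proof compares quadratic forms on a subspace of finite codimension. Suppose `K` has only
finitely many positive eigenvalues. Their eigenspaces span a finite-dimensional `W`, and `⟨Kv,v⟩ ≤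
0` on `Wᗮ` (`exists_finiteDimensional_re_inner_nonpos`), so `⟨Hv,v⟩ ≥ ⟨Uv,v⟩ ≥ 0` there. Every value
of `u`, in particular `0`, lies in the essential spectrum of `H` (`mem_essentialSpectrum_sub`), so
its lower edge is at most `0`.

The Efimov effect puts infinitely many eigenvalues below that edge. Their eigenvectors span an
infinite-dimensional space, which must meet `Wᗮ` in some `v ≠ 0`; for it `⟨Hv,v⟩` is strictly below
the edge times `‖v‖²` (`exists_mem_orthogonal_inner_lt`), a contradiction. Part (b) is the same
argument for `-H` and `-K`, with `max u` in place of `0`. -/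

theorem exists_mem_orthogonal_inner_lt {H : E →L[ℂ] E} (hH : (H : E →ₗ[ℂ] E).IsSymmetric)
    {c : ℝ} (hinf : {a : ℝ | a < c ∧ IsEigenvalue H a}.Infinite)
    (W : Submodule ℂ E) [FiniteDimensional ℂ W] :
    ∃ v ∈ Wᗮ, (inner ℂ (H v) v).re < c * ‖v‖ ^ 2 := by
  classical
  have : Infinite {a : ℝ | a < c ∧ IsEigenvalue H a} := hinf.to_subtype
  have hex : ∀ a : {a : ℝ | a < c ∧ IsEigenvalue H a}, ∃ e : E, ‖e‖ = 1 ∧ H e = (a.1 : ℂ) • e := by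
    intro a
    obtain ⟨x, hx⟩ := a.2.2.exists_hasEigenvector
    have hx0 : (‖x‖ : ℂ) ≠ 0 := by simpa using hx.2
    refine ⟨(‖x‖ : ℂ)⁻¹ • x, ?_, ?_⟩
    · rw [norm_smul, norm_inv, Complex.norm_real, norm_norm]
      exact inv_mul_cancel₀ (by simpa using hx.2)
    · rw [map_smul, smul_comm]
      congr 1
      exact hx.apply_eq_smul
  choose e he1 he using hex
  have hort : Orthonormal ℂ e := by
    refine ⟨he1, fun i j hij => ?_⟩
    have h : inner ℂ (H (e i)) (e j) = inner ℂ (e i) (H (e j)) := hH _ _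
    rw [he, he, inner_smul_left, inner_smul_right, Complex.conj_ofReal, ← sub_eq_zero,
      ← sub_mul] at h
    refine (mul_eq_zero.1 h).resolve_left ?_
    exact fun h' => hij (Subtype.ext (Complex.ofReal_injective (sub_eq_zero.1 h')))
  -- Projecting the infinite-dimensional span of the eigenvectors onto the finite-dimensional `W`
  -- has a nontrivial kernel, which is where `v` comes from.
  have hnot : ¬ Function.Injective
      ((W.orthogonalProjectionOnto : E →ₗ[ℂ] W) ∘ₗ Finsupp.linearCombination ℂ e) := by
    intro h
    have := Module.Finite.of_injective _ h
    exact (Module.Finite.finite_basis (R := ℂ) (Finsupp.basisSingleOne (R := ℂ)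
      (ι := {a : ℝ | a < c ∧ IsEigenvalue H a}))).not_infinite ‹_›
  rw [← LinearMap.ker_eq_bot, Submodule.eq_bot_iff] at hnot
  push Not at hnot
  obtain ⟨f, hf, hf0⟩ := hnot
  refine ⟨Finsupp.linearCombination ℂ e f, ?_, ?_⟩
  · rw [← Submodule.orthogonalProjectionOnto_eq_zero_iff]
    exact hf
  · have hHv : H (Finsupp.linearCombination ℂ e f)
        = ∑ i ∈ f.support, ((i.1 : ℂ) * f i) • e i := by
      rw [Finsupp.linearCombination_apply, Finsupp.sum, map_sum]
      refine Finset.sum_congr rfl fun i _ => ?_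
      rw [map_smul, he, smul_smul, mul_comm]
    have hv : Finsupp.linearCombination ℂ e f = ∑ i ∈ f.support, f i • e i := rfl
    have h1 : (inner ℂ (H (Finsupp.linearCombination ℂ e f)) (Finsupp.linearCombination ℂ e f)).re
        = ∑ i ∈ f.support, i.1 * ‖f i‖ ^ 2 := by
      rw [hHv, hv, hort.inner_sum, Complex.re_sum]
      refine Finset.sum_congr rfl fun i _ => ?_
      rw [map_mul, Complex.conj_ofReal, mul_assoc, Complex.conj_mul']
      norm_cast
    have h2 : ‖Finsupp.linearCombination ℂ e f‖ ^ 2 = ∑ i ∈ f.support, ‖f i‖ ^ 2 := by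
      have h3 : (inner ℂ (Finsupp.linearCombination ℂ e f) (Finsupp.linearCombination ℂ e f)).re
          = ∑ i ∈ f.support, ‖f i‖ ^ 2 := by
        rw [hv, hort.inner_sum, Complex.re_sum]
        refine Finset.sum_congr rfl fun i _ => ?_
        rw [Complex.conj_mul']
        norm_cast
      rw [← h3]
      exact (inner_self_eq_norm_sq (𝕜 := ℂ) _).symm
    rw [h1, h2, Finset.mul_sum]
    refine Finset.sum_lt_sum_of_nonempty (Finsupp.support_nonempty_iff.2 hf0) fun i hi => ?_
    have : 0 < ‖f i‖ := norm_pos_iff.2 (Finsupp.mem_support_iff.1 hi)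
    exact mul_lt_mul_of_pos_right i.2.1 (by positivity)

variable [CompleteSpace E]

/-- Nonzero spectral points of a compact operator are eigenvalues, so `-T` has nonnegative spectrum
and is therefore a positive operator. -/
theorem re_inner_nonpos_of_eigenvalues_nonpos {T : E →L[ℂ] E} (hT : IsCompactOperator T)
    (hsym : (T : E →ₗ[ℂ] E).IsSymmetric) (h : ∀ a : ℝ, 0 < a → ¬ IsEigenvalue T a) (v : E) :
    (inner ℂ (T v) v).re ≤ 0 := by
  have hsa : IsSelfAdjoint T := hsym.isSelfAdjoint
  have hneg : 0 ≤ -T := by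
    rw [StarOrderedRing.nonneg_iff_spectrum_nonneg (R := ℝ) (-T) (ha := hsa.neg)]
    intro x hx
    rw [← spectrum.neg_eq, Set.mem_neg] at hx
    by_contra hlt
    push Not at hlt
    refine h (-x) (by linarith) ?_
    rw [IsEigenvalue, hT.hasEigenvalue_iff_mem_spectrum (by exact_mod_cast (by linarith : -x ≠ 0))]
    exact (spectrum.algebraMap_mem_iff (S := ℂ)).2 hx
  have := ((ContinuousLinearMap.nonneg_iff_isPositive _).1 hneg).re_inner_nonneg_left v
  simpa using this

/-- By symmetry `Wᗮ` is invariant. The compact restriction of `T` to it has no positive eigenvalue,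
since an eigenvector would lie in both `W` and `Wᗮ`. -/
theorem exists_finiteDimensional_re_inner_nonpos {T : E →L[ℂ] E} (hT : IsCompactOperator T)
    (hsym : (T : E →ₗ[ℂ] E).IsSymmetric) (hfin : {a : ℝ | 0 < a ∧ IsEigenvalue T a}.Finite) :
    ∃ W : Submodule ℂ E, FiniteDimensional ℂ W ∧ ∀ v ∈ Wᗮ, (inner ℂ (T v) v).re ≤ 0 := by
  have := hfin.to_subtype
  let W : Submodule ℂ E := ⨆ a : {a : ℝ | 0 < a ∧ IsEigenvalue T a},
    Module.End.eigenspace (T : E →ₗ[ℂ] E) (a.1 : ℂ)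
  have hWfin : FiniteDimensional ℂ W := by
    have (a : {a : ℝ | 0 < a ∧ IsEigenvalue T a}) :
        FiniteDimensional ℂ (Module.End.eigenspace (T : E →ₗ[ℂ] E) (a.1 : ℂ)) :=
      ContinuousLinearMap.finite_dimensional_eigenspace hT _
        (by exact_mod_cast a.2.1.ne')
    exact Submodule.finiteDimensional_iSup _
  have hinv : ∀ v ∈ Wᗮ, T v ∈ Wᗮ := by
    intro v hv
    rw [Submodule.mem_orthogonal] at hv ⊢
    intro w hw
    have hTw : T w ∈ W := by
      have hle : W ≤ W.comap (T : E →ₗ[ℂ] E) := by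
        refine iSup_le fun a x hx => ?_
        rw [Submodule.mem_comap, Module.End.mem_eigenspace_iff.1 hx]
        exact W.smul_mem _ (Submodule.mem_iSup_of_mem a hx)
      exact hle hw
    rw [← hv _ hTw]
    exact (hsym w v).symm
  refine ⟨W, hWfin, fun v hv => ?_⟩
  let S : Wᗮ →L[ℂ] Wᗮ := T.restrict hinv
  have hS : IsCompactOperator S := hT.restrict' hinv
  have hSsym : (S : Wᗮ →ₗ[ℂ] Wᗮ).IsSymmetric := hsym.restrict_invariant hinv
  refine re_inner_nonpos_of_eigenvalues_nonpos hS hSsym (fun a ha hev => ?_) ⟨v, hv⟩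
  obtain ⟨x, hx⟩ := hev.exists_hasEigenvector
  have hxT : T x = (a : ℂ) • (x : E) := congrArg Subtype.val hx.apply_eq_smul
  have hx0 : (x : E) ≠ 0 := fun h => hx.2 (Subtype.ext h)
  have hxe : (x : E) ∈ Module.End.eigenspace (T : E →ₗ[ℂ] E) (a : ℂ) :=
    Module.End.mem_eigenspace_iff.2 hxT
  have hxW : (x : E) ∈ W := Submodule.mem_iSup_of_mem
    (⟨a, ha, Module.End.hasEigenvalue_of_hasEigenvector ⟨hxe, hx0⟩⟩ :
      {a : ℝ | 0 < a ∧ IsEigenvalue T a}) hxe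
  exact hx0 (inner_self_eq_zero.1 (x.2 _ hxW))

/-- One half of Weyl's criterion. If `T - l` were invertible, its inverse would force `f n → 0`. If
`l` were discrete, functional calculus would give an inverse modulo the spectral projection onto a
finite-dimensional eigenspace, where weak convergence is norm convergence; again `f n → 0`. -/
theorem mem_essentialSpectrum_of_tendsto {T : E →L[ℂ] E} (hsym : (T : E →ₗ[ℂ] E).IsSymmetric)
    {l : ℝ} {f : ℕ → E} (hf : ∀ n, ‖f n‖ = 1) (hweak : ∀ x, Tendsto (fun n => inner ℂ x (f n)) atTop (𝓝 0))
    (hlim : Tendsto (fun n => T (f n) - (l : ℂ) • f n) atTop (𝓝 0)) :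
    l ∈ essentialSpectrum T := by
  have hne : ¬ Tendsto f atTop (𝓝 0) := by
    intro h
    have := h.norm
    simp only [hf, norm_zero] at this
    exact one_ne_zero (tendsto_nhds_unique tendsto_const_nhds this)
  have hsa : IsSelfAdjoint T := hsym.isSelfAdjoint
  have hsub : ∀ x, (T - algebraMap ℝ (E →L[ℂ] E) l) x = T x - (l : ℂ) • x := by
    intro x
    simp [Algebra.algebraMap_eq_smul_one]
  refine ⟨?_, ?_⟩
  · by_contra hns
    have hns' : l ∉ spectrum ℝ T := fun h => hns ((spectrum.algebraMap_mem_iff (S := ℂ)).2 h)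
    rw [spectrum.notMem_iff, ← IsUnit.neg_iff, neg_sub] at hns'
    obtain ⟨S, hS⟩ := hns'.exists_left_inv
    apply hne
    have := (S.continuous.tendsto 0).comp hlim
    rw [map_zero] at this
    refine this.congr fun n => ?_
    rw [Function.comp_apply, ← hsub]
    exact DFunLike.congr_fun hS (f n)
  · rintro ⟨-, hfd, d, hd, hiso⟩
    have hspec : ∀ x ∈ spectrum ℝ T, x ∈ Set.Ioo (l - d) (l + d) → x = l := by
      intro x hx hxd
      have : x ∈ Set.Ioo (l - d) (l + d) ∩ realSpectrum T :=
        ⟨hxd, (spectrum.algebraMap_mem_iff (S := ℂ)).2 hx⟩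
      rwa [hiso] at this
    -- Since `l` is isolated in the spectrum, continuity there is automatic.
    have hevl : ∀ x ∈ spectrum ℝ T, ∀ g : ℝ → ℝ, (x ≠ l → ContinuousAt g x) →
        ContinuousWithinAt g (spectrum ℝ T) x := by
      intro x hx g hg
      by_cases hxl : x = l
      · subst hxl
        have : Set.Ioo (x - d) (x + d) ∈ 𝓝 x := Ioo_mem_nhds (by linarith) (by linarith)
        refine (continuousWithinAt_const (b := g x)).congr_of_eventuallyEq ?_ rfl
        filter_upwards [self_mem_nhdsWithin, mem_nhdsWithin_of_mem_nhds this] with y hy hy'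
        rw [hspec y hy hy']
      · exact (hg hxl).continuousWithinAt
    let p : ℝ → ℝ := fun x => if x = l then 1 else 0
    have hp : ContinuousOn p (spectrum ℝ T) := by
      intro x hx
      refine hevl x hx _ fun hxl => ?_
      refine (continuousAt_const (y := (0 : ℝ))).congr ?_
      filter_upwards [isOpen_ne.mem_nhds hxl] with y hy
      exact (if_neg hy).symm
    -- The default value `g l = 0` is harmless: `g x * (x - l) + p x = 1` still holds at `l`,
    -- through `p`.
    let g : ℝ → ℝ := fun x => (x - l)⁻¹
    have hg : ContinuousOn g (spectrum ℝ T) := by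
      intro x hx
      exact hevl x hx _ fun hxl => (continuousAt_id.sub continuousAt_const).inv₀ (sub_ne_zero.2 hxl)
    have hcl : ContinuousOn (fun x : ℝ => x - l) (spectrum ℝ T) := by fun_prop
    have hTl : cfc (fun x : ℝ => x - l) T = T - algebraMap ℝ (E →L[ℂ] E) l := by
      rw [cfc_sub (fun x => x) (fun _ => l) T, cfc_id' ℝ T, cfc_const l T]
    have h1 : cfc g T * (T - algebraMap ℝ (E →L[ℂ] E) l) + cfc p T = 1 := by
      rw [← hTl, ← cfc_mul g _ T, ← cfc_add T (fun x => g x * (x - l)) p (hg.mul hcl) hp,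
        ← cfc_const_one ℝ T]
      refine cfc_congr fun x _ => ?_
      by_cases hxl : x = l
      · simp [g, p, hxl]
      · simp [g, p, hxl, sub_ne_zero.2 hxl]
    have h2 : (T - algebraMap ℝ (E →L[ℂ] E) l) * cfc p T = 0 := by
      rw [← hTl, ← cfc_mul _ _ T, ← cfc_zero ℝ T]
      refine cfc_congr fun x _ => ?_
      by_cases hxl : x = l
      · simp [hxl]
      · simp [p, hxl]
    have hpsa : IsSelfAdjoint (cfc p T) := cfc_predicate p T
    have hrange : ∀ x, cfc p T x ∈ Module.End.eigenspace (T : E →ₗ[ℂ] E) (l : ℂ) := by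
      intro x
      rw [Module.End.mem_eigenspace_iff, ← sub_eq_zero]
      have := DFunLike.congr_fun h2 x
      rw [mul_apply_eq_comp, hsub] at this
      exact this
    have hP : Tendsto (fun n => cfc p T (f n)) atTop (𝓝 0) := by
      let N := Module.End.eigenspace (T : E →ₗ[ℂ] E) (l : ℂ)
      let b := stdOrthonormalBasis ℂ N
      have hrep : ∀ n, cfc p T (f n)
          = ∑ i, inner ℂ (cfc p T (b i : E)) (f n) • (b i : E) := by
        intro n
        have := congrArg Subtype.val (b.sum_repr' ⟨cfc p T (f n), hrange (f n)⟩)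
        rw [Submodule.coe_sum] at this
        refine this.symm.trans (Finset.sum_congr rfl fun i _ => ?_)
        rw [Submodule.coe_smul, Submodule.coe_inner]
        congr 1
        exact (hpsa.isSymmetric _ _).symm
      simp_rw [hrep]
      rw [← Finset.sum_const_zero (s := (Finset.univ : Finset (Fin (Module.finrank ℂ N)))) (M := E)]
      refine tendsto_finsetSum _ fun i _ => ?_
      rw [← zero_smul ℂ (b i : E)]
      exact (hweak _).smul_const _
    apply hne
    have := (((cfc g T).continuous.tendsto 0).comp hlim).add hP
    rw [map_zero, add_zero] at this
    refine this.congr fun n => ?_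
    rw [Function.comp_apply, ← hsub]
    exact DFunLike.congr_fun h1 (f n)

/-- Gives the boundedness needed for `sInf` and `sSup` to be genuine bounds. The factor `‖1‖` covers
the trivial space, where it is `0`. -/
theorem abs_le_norm_of_mem_realSpectrum {A : E →L[ℂ] E} {l : ℝ} (hl : l ∈ realSpectrum A) :
    |l| ≤ ‖A‖ * ‖(1 : E →L[ℂ] E)‖ := by
  have := spectrum.norm_le_norm_mul_of_mem (show (l : ℂ) ∈ spectrum ℂ A from hl)
  rwa [Complex.norm_real] at this

theorem lowerEdge_le {A : E →L[ℂ] E} {l : ℝ} (hl : l ∈ essentialSpectrum A) : lowerEdge A ≤ l :=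
  csInf_le ⟨_, fun _ hx => (abs_le.1 (abs_le_norm_of_mem_realSpectrum hx.1)).1⟩ hl

theorem le_upperEdge {A : E →L[ℂ] E} {l : ℝ} (hl : l ∈ essentialSpectrum A) : l ≤ upperEdge A :=
  le_csSup ⟨_, fun _ hx => (abs_le.1 (abs_le_norm_of_mem_realSpectrum hx.1)).2⟩ hl

end Abstract

theorem infinite_of_tendsto {s : Set ℝ} {l : ℝ} {a : ℕ → ℝ} (ha : ∀ n, a n ∈ s) (hl : ∀ n, a n ≠ l)
    (h : Tendsto a atTop (𝓝 l)) : s.Infinite := by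
  intro hs
  obtain ⟨n, hn⟩ := (hs.subset (Set.range_subset_iff.2 ha)).isClosed.mem_of_tendsto h
    (Eventually.of_forall fun n => Set.mem_range_self n)
  exact hl n hn


/-! ### Symmetry and quadratic forms of `U` and `K`. -/

theorem isSymmetric_mulOp (u : C(I, ℝ)) : (mulOp u : L2 →ₗ[ℂ] L2).IsSymmetric := by
  intro f g
  change inner ℂ (mulOp u f) g = inner ℂ f (mulOp u g)
  rw [L2.inner_def, L2.inner_def]
  refine integral_congr_ae ?_
  filter_upwards [mulOp_apply u f, mulOp_apply u g] with t hf hg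
  rw [hf, hg]
  simp only [RCLike.inner_apply, map_mul, Complex.conj_ofReal]
  ring

theorem re_inner_mulOp (u : C(I, ℝ)) (f : L2) :
    (inner ℂ (mulOp u f) f).re = ∫ t : I, u t * ‖f t‖ ^ 2 := by
  rw [L2.inner_def]
  have : (fun t => inner ℂ (mulOp u f t) (f t)) =ᵐ[volume]
      fun t : I => ((u t * ‖f t‖ ^ 2 : ℝ) : ℂ) := by
    filter_upwards [mulOp_apply u f] with t hf
    rw [hf]
    simp only [RCLike.inner_apply, map_mul, Complex.conj_ofReal]
    rw [mul_left_comm, Complex.mul_conj']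
    push_cast
    rfl
  rw [integral_congr_ae this, integral_complex_ofReal]
  exact Complex.ofReal_re _

theorem integrable_norm_sq (f : L2) : Integrable (fun t : I => ‖f t‖ ^ 2) volume :=
  (memLp_two_iff_integrable_sq_norm (Lp.aestronglyMeasurable f)).1 (Lp.memLp f)

theorem norm_sq_eq_integral (f : L2) : ‖f‖ ^ 2 = ∫ t : I, ‖f t‖ ^ 2 := by
  have h : ‖f‖ ^ 2 = (inner ℂ f f).re := (inner_self_eq_norm_sq (𝕜 := ℂ) f).symm
  rw [h, L2.inner_def]
  have : (fun t => inner ℂ (f t) (f t)) = fun t : I => ((‖f t‖ ^ 2 : ℝ) : ℂ) := by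
    funext t
    rw [inner_self_eq_norm_sq_to_K]
    push_cast
    rfl
  rw [this, integral_complex_ofReal]
  exact Complex.ofReal_re _

theorem re_inner_mulOp_nonneg (u : C(I, ℝ)) (hu : ∀ t, 0 ≤ u t) (f : L2) :
    0 ≤ (inner ℂ (mulOp u f) f).re := by
  rw [re_inner_mulOp]
  exact integral_nonneg fun t => mul_nonneg (hu t) (sq_nonneg _)

theorem re_inner_mulOp_le (u : C(I, ℝ)) {M : ℝ} (hM : ∀ t, u t ≤ M) (f : L2) :
    (inner ℂ (mulOp u f) f).re ≤ M * ‖f‖ ^ 2 := by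
  rw [re_inner_mulOp, norm_sq_eq_integral, ← integral_const_mul]
  refine integral_mono ((integrable_norm_sq f).bdd_mul (c := ‖u‖) u.continuous.aestronglyMeasurable
    (Eventually.of_forall u.norm_coe_le_norm)) ((integrable_norm_sq f).const_mul M) fun t => ?_
  exact mul_le_mul_of_nonneg_right (hM t) (sq_nonneg _)

theorem integrable_kernel_mul (k : Kernel2) (f g : L2) :
    Integrable (fun p : I × I => k p * (g p.1 * f p.2)) (volume.prod volume) := by
  have h : MemLp (fun p : I × I => g p.1 * f p.2) 2 (volume.prod volume) := by
    have hm : AEStronglyMeasurable (fun p : I × I => g p.1 * f p.2) (volume.prod volume) :=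
      (Lp.aestronglyMeasurable g).comp_fst.mul (Lp.aestronglyMeasurable f).comp_snd
    rw [memLp_two_iff_integrable_sq_norm hm]
    simpa only [norm_mul, mul_pow] using (integrable_norm_sq g).mul_prod (integrable_norm_sq f)
  exact (Lp.memLp k).integrable_mul h

theorem inner_integralOp (k : Kernel2) (f g : L2) :
    inner ℂ g (integralOp k f) = ∫ p : I × I, k p * (conj (g p.1) * f p.2) := by
  have hint : Integrable (fun p : I × I => k p * (conj (g p.1) * f p.2))
      (volume.prod volume) := by
    refine (integrable_congr ?_).1 (integrable_kernel_mul k f (star g))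
    have h : ∀ᵐ p : I × I ∂(volume.prod volume), (star g : L2) p.1 = star (g p.1) :=
      Measure.quasiMeasurePreserving_fst.ae (Lp.coeFn_star g)
    filter_upwards [h] with p hp
    rw [hp]
    rfl
  refine Eq.trans ?_ (integral_prod _ hint).symm
  rw [L2.inner_def]
  refine integral_congr_ae ?_
  filter_upwards [integralOp_apply k f] with t ht
  rw [ht, RCLike.inner_apply, mul_comm, ← integral_const_mul]
  refine integral_congr_ae (Eventually.of_forall fun s => ?_)
  change _ = k (t, s) * (conj (g t) * f s)
  ring

theorem isSymmetric_integralOp {k : Kernel2} (hk : IsHermitianKernel k) :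
    (integralOp k : L2 →ₗ[ℂ] L2).IsSymmetric := by
  intro f g
  change inner ℂ (integralOp k f) g = inner ℂ f (integralOp k g)
  rw [← inner_conj_symm, inner_integralOp, inner_integralOp, ← integral_conj]
  refine (integral_prod_swap (μ := (volume : Measure I)) (ν := (volume : Measure I))
    (fun p : I × I => conj (k p * (conj (g p.1) * f p.2)))).symm.trans ?_
  have hk' : ∀ᵐ p : I × I, k p = conj (k p.swap) := hk
  refine integral_congr_ae ?_
  filter_upwards [hk'] with p hp
  change conj (k p.swap * (conj (g p.2) * f p.1)) = k p * (conj (f p.1) * g p.2)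
  rw [hp]
  simp only [map_mul, Complex.conj_conj]
  ring

/-! ### Compactness of the integral operator. -/

/-- For almost every `t` the section `k(t,·)` is square-integrable, so weak convergence gives `(K
fₙ)(t) → 0`. Dominated convergence with majorant `C²‖k(t,·)‖²` finishes. -/
theorem tendsto_integralOp_zero (k : Kernel2) {f : ℕ → L2} {C : ℝ} (hC : ∀ n, ‖f n‖ ≤ C)
    (hweak : ∀ x, Tendsto (fun n => inner ℂ x (f n)) atTop (𝓝 0)) :
    Tendsto (fun n => integralOp k (f n)) atTop (𝓝 0) := by
  have hm : Measurable (fun t : I => ∫⁻ s : I, ‖k (t, s)‖ₑ ^ (2 : ℝ)) :=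
    ((Lp.stronglyMeasurable k).enorm.pow_const (2 : ℝ)).lintegral_prod_right'
  have hfin : ∫⁻ t : I, ∫⁻ s : I, ‖k (t, s)‖ₑ ^ (2 : ℝ) ≠ ⊤ := by
    rw [lintegral_sq]
    exact ENNReal.rpow_ne_top_of_nonneg (by norm_num) (Lp.eLpNorm_ne_top k)
  have hfC : ∀ n, eLpNorm (f n) 2 volume ≤ ENNReal.ofReal C := by
    intro n
    rw [← ENNReal.ofReal_toReal (Lp.eLpNorm_ne_top (f n)), ← Lp.norm_def]
    exact ENNReal.ofReal_le_ofReal (hC n)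
  have hlim : Tendsto (fun n => ∫⁻ t : I, ‖∫ s : I, k (t, s) * f n s‖ₑ ^ (2 : ℝ)) atTop
      (𝓝 (∫⁻ _ : I, 0)) := by
    refine tendsto_lintegral_of_dominated_convergence'
      (fun t => (∫⁻ s : I, ‖k (t, s)‖ₑ ^ (2 : ℝ)) * ENNReal.ofReal C ^ (2 : ℝ))
      (fun n => (aestronglyMeasurable_kernel k (f n)).enorm.pow_const _)
      (fun n => Eventually.of_forall fun t => ?_) ?_ ?_
    · calc ‖∫ s : I, k (t, s) * f n s‖ₑ ^ (2 : ℝ)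
          ≤ ((∫⁻ s : I, ‖k (t, s)‖ₑ ^ (2 : ℝ)) ^ (1 / 2 : ℝ) * ENNReal.ofReal C) ^ (2 : ℝ) := by
            gcongr
            refine (enorm_integral_le_lintegral_enorm _).trans ((kernel_pointwise k (f n) t).trans ?_)
            gcongr
            exact hfC n
        _ = _ := by
            rw [ENNReal.mul_rpow_of_nonneg _ _ (by norm_num), ← ENNReal.rpow_mul]
            norm_num
    · rw [lintegral_mul_const _ hm]
      exact ENNReal.mul_ne_top hfin
        (ENNReal.rpow_ne_top_of_nonneg (by norm_num) ENNReal.ofReal_ne_top)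
    · filter_upwards [ae_lt_top hm hfin] with t ht
      have hms : AEStronglyMeasurable (fun s : I => k (t, s)) volume :=
        ((Lp.stronglyMeasurable k).comp_measurable measurable_prodMk_left).aestronglyMeasurable
      have hmem : MemLp (fun s : I => conj (k (t, s))) 2 volume := by
        refine MemLp.star (f := fun s : I => k (t, s)) ⟨hms, ?_⟩
        rw [eLpNorm_eq_lintegral_rpow_enorm_toReal two_ne_zero ENNReal.ofNat_ne_top]
        exact ENNReal.rpow_lt_top_of_nonneg (by norm_num) (by simpa using ht.ne)
      have h0 : ∀ n, inner ℂ (hmem.toLp _) (f n) = ∫ s : I, k (t, s) * f n s := by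
        intro n
        rw [L2.inner_def]
        refine integral_congr_ae ?_
        filter_upwards [hmem.coeFn_toLp] with s hs
        rw [hs, RCLike.inner_apply, Complex.conj_conj, mul_comm]
      have h1 := hweak (hmem.toLp _)
      simp_rw [h0] at h1
      have h2 := (h1.enorm).ennrpow_const 2
      simpa using h2
  rw [lintegral_zero] at hlim
  rw [tendsto_zero_iff_norm_tendsto_zero]
  have hnorm : ∀ n, ‖integralOp k (f n)‖
      = ((∫⁻ t : I, ‖∫ s : I, k (t, s) * f n s‖ₑ ^ (2 : ℝ)) ^ (1 / 2 : ℝ)).toReal := by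
    intro n
    rw [Lp.norm_def, eLpNorm_congr_ae (integralOp_apply k (f n)),
      eLpNorm_eq_lintegral_rpow_enorm_toReal two_ne_zero ENNReal.ofNat_ne_top]
    rfl
  simp_rw [hnorm]
  have h3 := hlim.ennrpow_const (1 / 2)
  rw [ENNReal.zero_rpow_of_pos (by norm_num)] at h3
  exact (ENNReal.tendsto_toReal ENNReal.zero_ne_top).comp h3

/-- Sequential Banach–Alaoglu extracts a weakly convergent subsequence from the unit ball, and `K`
turns weak convergence into norm convergence. -/
theorem isCompactOperator_integralOp (k : Kernel2) : IsCompactOperator (integralOp k) := by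
  refine ⟨integralOp k '' Metric.closedBall 0 1, ?_,
    mem_of_superset (Metric.closedBall_mem_nhds 0 one_pos) (Set.subset_preimage_image _ _)⟩
  refine IsSeqCompact.isCompact fun y hy => ?_
  choose x hx hxy using hy
  simp only [mem_closedBall_zero_iff] at hx
  have : Fact ((2 : ℝ≥0∞) ≠ ∞) := ⟨ENNReal.ofNat_ne_top⟩
  obtain ⟨φ, hφ, j, hj, hlim⟩ := WeakDual.isSeqCompact_closedBall (𝕜 := ℂ) (E := L2) 0 1
    (x := fun n => StrongDual.toWeakDual (InnerProductSpace.toDual ℂ L2 (x n))) (fun n => by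
      simpa using hx n)
  let z : L2 := (InnerProductSpace.toDual ℂ L2).symm (WeakDual.toStrongDual φ)
  have hz : ‖z‖ ≤ 1 := by simpa [z] using hφ
  refine ⟨integralOp k z, ⟨z, by simpa using hz, rfl⟩, j, hj, ?_⟩
  have hw : ∀ v, Tendsto (fun n => inner ℂ v (x (j n) - z)) atTop (𝓝 0) := by
    intro v
    have h := (WeakDual.eval_continuous v).continuousAt.tendsto.comp hlim
    have h1 : Tendsto (fun n => inner ℂ (x (j n)) v) atTop (𝓝 (inner ℂ z v)) := by
      have hzv : inner ℂ z v = φ v := InnerProductSpace.toDual_symm_apply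
      rw [hzv]
      exact h
    have h2 := ((Complex.continuous_conj.tendsto _).comp h1).sub_const (inner ℂ v z)
    simp only [inner_conj_symm, sub_self, Function.comp_def] at h2
    simpa only [inner_sub_right] using h2
  have h := tendsto_integralOp_zero k (C := 1 + 1)
    (fun n => (norm_sub_le _ _).trans (add_le_add (hx (j n)) hz)) hw
  rw [← tendsto_sub_nhds_zero_iff]
  refine h.congr fun n => ?_
  rw [map_sub, Function.comp_apply, hxy]


/-! ### Weyl sequences: the values of `u` are in the essential spectrum. -/

/-- Only `x` restricted to `B n` matters, and its norm tends to `0` by absolute continuity of the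
integral. -/
theorem tendsto_inner_of_support {f : ℕ → L2} {B : ℕ → Set I} (hB : ∀ n, MeasurableSet (B n))
    (hμ : Tendsto (fun n => volume (B n)) atTop (𝓝 0)) (hf : ∀ n, ‖f n‖ = 1)
    (hsupp : ∀ n, ∀ᵐ t : I, t ∉ B n → f n t = 0) (x : L2) :
    Tendsto (fun n => inner ℂ x (f n)) atTop (𝓝 0) := by
  have hmem : ∀ n, MemLp ((B n).indicator x) 2 volume := fun n => (Lp.memLp x).indicator (hB n)
  have heq : ∀ n, inner ℂ x (f n) = inner ℂ ((hmem n).toLp _) (f n) := by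
    intro n
    rw [L2.inner_def, L2.inner_def]
    refine integral_congr_ae ?_
    filter_upwards [(hmem n).coeFn_toLp, hsupp n] with t ht hs
    rw [ht]
    by_cases htB : t ∈ B n
    · rw [Set.indicator_of_mem htB]
    · rw [hs htB, inner_zero_right, inner_zero_right]
  rw [Metric.tendsto_atTop]
  intro ε hε
  obtain ⟨δ, hδ, h⟩ := (Lp.memLp x).eLpNorm_indicator_le one_le_two ENNReal.ofNat_ne_top
    (half_pos hε)
  obtain ⟨N, hN⟩ := eventually_atTop.1
    (hμ.eventually_le_const (u := ENNReal.ofReal δ) (ENNReal.ofReal_pos.2 hδ))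
  refine ⟨N, fun n hn => ?_⟩
  rw [dist_zero_right, heq]
  refine (norm_inner_le_norm _ _).trans_lt ?_
  rw [hf, mul_one, Lp.norm_toLp]
  refine (ENNReal.toReal_le_of_le_ofReal (half_pos hε).le (h _ (hB n) (hN n hn))).trans_lt ?_
  linarith

theorem exists_normalized_support {s : Set I} (hs : MeasurableSet s) (h0 : volume s ≠ 0) :
    ∃ f : L2, ‖f‖ = 1 ∧ ∀ᵐ t : I, t ∉ s → f t = 0 := by
  let g : L2 := indicatorConstLp 2 hs (measure_ne_top _ _) (1 : ℂ)
  have hg : ‖g‖ ≠ 0 := by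
    rw [norm_indicatorConstLp two_ne_zero ENNReal.ofNat_ne_top, norm_one, one_mul]
    have : 0 < (volume : Measure I).real s := ENNReal.toReal_pos h0 (measure_ne_top _ _)
    positivity
  refine ⟨((‖g‖ : ℂ)⁻¹) • g, ?_, ?_⟩
  · rw [norm_smul, norm_inv, Complex.norm_real, norm_norm, inv_mul_cancel₀ hg]
  · filter_upwards [Lp.coeFn_smul ((‖g‖ : ℂ)⁻¹) g, (indicatorConstLp_coeFn :
      g =ᵐ[volume] s.indicator fun _ => (1 : ℂ))] with t h1 h2 ht
    rw [h1, Pi.smul_apply, h2, Set.indicator_of_notMem ht, smul_zero]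

instance isOpenPosMeasure_volume_unitInterval : (volume : Measure I).IsOpenPosMeasure := by
  refine ⟨fun U hU ⟨x, hx⟩ h0 => ?_⟩
  obtain ⟨V, hV, rfl⟩ := isOpen_induced_iff.1 hU
  -- An endpoint of `[0,1]` need not be interior in `ℝ`, so the open set is first intersected with
  -- `(0,1)`.
  have hxcl : (x : ℝ) ∈ closure (Set.Ioo (0 : ℝ) 1) := by
    rw [closure_Ioo zero_ne_one]
    exact x.2
  refine ((hV.inter isOpen_Ioo).measure_pos volume (mem_closure_iff.1 hxcl V hV hx)).ne' ?_
  rw [volume_set_coe_def, comap_subtype_coe_apply measurableSet_Icc,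
    Subtype.image_preimage_coe] at h0
  exact measure_mono_null (t := Set.Icc 0 1 ∩ V) (fun y hy => ⟨Set.Ioo_subset_Icc_self hy.2, hy.1⟩) h0

/-- Normalized indicators of neighbourhoods shrinking to `t₀` form a Weyl sequence: `U - u t₀` is
small on them by continuity, and `K` sends them to `0` because they converge weakly to `0`. -/
theorem mem_essentialSpectrum_sub (u : C(I, ℝ)) {k : Kernel2} (hk : IsHermitianKernel k) (t₀ : I) :
    u t₀ ∈ essentialSpectrum (mulOp u - integralOp k) := by
  have hex : ∀ n : ℕ, ∃ V : Set I, IsOpen V ∧ t₀ ∈ V ∧ volume V < ((n : ℝ≥0∞) + 1)⁻¹ := by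
    intro n
    obtain ⟨V, hV, hVo, hVμ⟩ := Set.exists_isOpen_lt_of_lt {t₀} (((n : ℝ≥0∞) + 1)⁻¹)
      (μ := volume) (by simp)
    exact ⟨V, hVo, hV rfl, hVμ⟩
  choose V hVo hV0 hVμ using hex
  let B : ℕ → Set I := fun n => {t | |u t - u t₀| < 1 / ((n : ℝ) + 1)} ∩ V n
  have hBo : ∀ n, IsOpen (B n) := fun n =>
    (isOpen_lt (by fun_prop) continuous_const).inter (hVo n)
  have hB0 : ∀ n, t₀ ∈ B n := fun n =>
    ⟨by simp only [Set.mem_ofPred_eq, sub_self, abs_zero]; positivity, hV0 n⟩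
  have hBμ : Tendsto (fun n => volume (B n)) atTop (𝓝 0) := by
    refine tendsto_of_tendsto_of_tendsto_of_le_of_le tendsto_const_nhds
      ENNReal.tendsto_inv_nat_nhds_zero (fun _ => zero_le) fun n => ?_
    refine (measure_mono Set.inter_subset_right).trans ((hVμ n).le.trans ?_)
    exact ENNReal.inv_le_inv.2 le_self_add
  choose f hf1 hfs using fun n => exists_normalized_support (hBo n).measurableSet
    ((hBo n).measure_pos volume ⟨t₀, hB0 n⟩).ne'
  have hweak := tendsto_inner_of_support (fun n => (hBo n).measurableSet) hBμ hf1 hfs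
  have hU : Tendsto (fun n => mulOp u (f n) - (u t₀ : ℂ) • f n) atTop (𝓝 0) := by
    refine squeeze_zero_norm (fun n => ?_) tendsto_one_div_add_atTop_nhds_zero_nat
    rw [← mul_one (1 / ((n : ℝ) + 1))]
    nth_rewrite 3 [← hf1 n]
    refine Lp.norm_le_mul_norm_of_ae_le_mul ?_
    filter_upwards [hfs n, mulOp_apply u (f n), Lp.coeFn_smul (u t₀ : ℂ) (f n),
      Lp.coeFn_sub (mulOp u (f n)) ((u t₀ : ℂ) • f n)] with t h1 h2 h3 h4
    rw [h4, Pi.sub_apply, h2, h3, Pi.smul_apply, smul_eq_mul, ← sub_mul, norm_mul,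
      ← Complex.ofReal_sub, Complex.norm_real]
    by_cases ht : t ∈ B n
    · exact mul_le_mul_of_nonneg_right ht.1.le (norm_nonneg _)
    · simp [h1 ht]
  refine mem_essentialSpectrum_of_tendsto
    ((isSymmetric_mulOp u).sub (isSymmetric_integralOp hk)) hf1 hweak ?_
  have h := hU.sub (tendsto_integralOp_zero k (fun n => (hf1 n).le) hweak)
  rw [sub_zero] at h
  refine h.congr fun n => ?_
  rw [sub_apply]
  abel

/-! ### Sign change and conclusion. -/

theorem isSymmetric_neg {E : Type*} [NormedAddCommGroup E] [InnerProductSpace ℂ E]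
    {A : E →L[ℂ] E} (h : (A : E →ₗ[ℂ] E).IsSymmetric) : ((-A : E →L[ℂ] E) : E →ₗ[ℂ] E).IsSymmetric := by
  intro x y
  change inner ℂ (-(A x)) y = inner ℂ x (-(A y))
  rw [inner_neg_left, inner_neg_right, neg_inj]
  exact h x y

theorem IsEigenvalue.neg {E : Type*} [NormedAddCommGroup E] [InnerProductSpace ℂ E]
    {A : E →L[ℂ] E} {a : ℝ} (h : IsEigenvalue A a) : IsEigenvalue (-A) (-a) := by
  obtain ⟨x, hx⟩ := h.exists_hasEigenvector
  have hA : A x = (a : ℂ) • x := hx.apply_eq_smul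
  refine Module.End.hasEigenvalue_of_hasEigenvector
    (x := x) ⟨Module.End.mem_eigenspace_iff.2 ?_, hx.2⟩
  change -(A x) = _
  rw [hA, Complex.ofReal_neg, neg_smul]

end Friedrichs

theorem mainTheorem5 (u : C(unitInterval, ℝ)) (hu : ∀ t, 0 ≤ u t) (hu0 : ∃ t, u t = 0)
    (k : Friedrichs.Kernel2) (hk : Friedrichs.IsHermitianKernel k) :
    (Friedrichs.EfimovBelow (Friedrichs.mulOp u - Friedrichs.integralOp k) →
      {a : ℝ | 0 < a ∧ Friedrichs.IsEigenvalue (Friedrichs.integralOp k) a}.Infinite) ∧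
    (Friedrichs.EfimovAbove (Friedrichs.mulOp u - Friedrichs.integralOp k) →
      {a : ℝ | a < 0 ∧ Friedrichs.IsEigenvalue (Friedrichs.integralOp k) a}.Infinite) := by
  open Friedrichs in
  have hKsym := isSymmetric_integralOp hk
  have hHsym := (isSymmetric_mulOp u).sub hKsym
  have hKc := isCompactOperator_integralOp k
  constructor
  · rintro ⟨-, -, a, hev, hlt, hlim⟩ hfin
    obtain ⟨W, hW, hWK⟩ := exists_finiteDimensional_re_inner_nonpos hKc hKsym hfin
    obtain ⟨t₀, ht₀⟩ := hu0
    have hedge := lowerEdge_le (mem_essentialSpectrum_sub u hk t₀)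
    rw [ht₀] at hedge
    obtain ⟨v, hv, hvlt⟩ := exists_mem_orthogonal_inner_lt (H := mulOp u - integralOp k) hHsym
      (infinite_of_tendsto (fun n => ⟨hlt n, hev n⟩) (fun n => (hlt n).ne) hlim) W
    have h1 := hWK v hv
    have h2 := re_inner_mulOp_nonneg u hu v
    have h3 := mul_nonpos_of_nonpos_of_nonneg hedge (sq_nonneg ‖v‖)
    rw [sub_apply, inner_sub_left, Complex.sub_re] at hvlt
    linarith
  · rintro ⟨-, -, a, hev, hlt, hlim⟩ hfin
    have hfin' : {a : ℝ | 0 < a ∧ IsEigenvalue (-integralOp k) a}.Finite := by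
      refine (hfin.image Neg.neg).subset fun b hb => ⟨-b, ⟨neg_lt_zero.2 hb.1, ?_⟩, neg_neg b⟩
      simpa using hb.2.neg
    obtain ⟨W, hW, hWK⟩ := exists_finiteDimensional_re_inner_nonpos (T := -integralOp k)
      hKc.neg (isSymmetric_neg hKsym) hfin'
    -- The maximum of `u` is attained, hence lies in the essential spectrum and is at most the upper
    -- edge.
    obtain ⟨t₀, -, ht₀⟩ := isCompact_univ.exists_isMaxOn Set.univ_nonempty u.continuous.continuousOn
    have hedge := le_upperEdge (mem_essentialSpectrum_sub u hk t₀)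
    obtain ⟨v, hv, hvlt⟩ := exists_mem_orthogonal_inner_lt (H := -(mulOp u - integralOp k))
      (c := -upperEdge (mulOp u - integralOp k)) (isSymmetric_neg hHsym)
      (infinite_of_tendsto (fun n => ⟨neg_lt_neg (hlt n), (hev n).neg⟩)
        (fun n => (neg_lt_neg (hlt n)).ne) hlim.neg) W
    have h1 := hWK v hv
    have h2 := re_inner_mulOp_le u (fun t => ht₀ (Set.mem_univ t)) v
    have h3 := mul_le_mul_of_nonneg_right hedge (sq_nonneg ‖v‖)
    rw [neg_apply, inner_neg_left, Complex.neg_re] at h1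
    rw [neg_apply, sub_apply, inner_neg_left, inner_sub_left, Complex.neg_re,
      Complex.sub_re] at hvlt
    linarith
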